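/- **Theorem (General Exponential Period Formula).** For every integer $n\ge 0$ there is an asymptotic expansion, as the integer $s\to+\infty$, $$\sum_{k=1}^{s} k^n\log k = A_n(s)\log s + B_n(s) + S_n + R_n(1/s),$$ where $A_n\in\mathbb{Q}[s]$, $B_n\in s\,\mathbb{Q}[s]$, $S_n\in\mathbb R$ and $R_n(1/s)\in \frac1s\mathbb{Q}[[\frac1s]]$ is an asymptotic series (in the sense of Poincaré). This determines the real number $S_n$ uniquely; it is called the $n$-th Stirling–Ramanujan constant. It is given by $$S_n = (-1)^{n+1}\, n! \int_0^{+\infty} \frac{1}{t^n}\left(\frac{1}{1-e^{-t}}-\sum_{k=-1}^{n} b_k t^k - r_n t^{n+1}\right)\frac{e^{-t}\,dt}{t},$$ where the integral converges absolutely. Here $(b_k)_{k\ge -1}$ are the rational coefficients of the Laurent expansion $$\frac{1}{1-e^{-t}}=\sum_{k=-1}^{+\infty} b_k t^k \qquad (0<|t|<2\pi),$$ they are given by $b_k=(-1)^{k+1}\frac{B_{k+1}}{(k+1)!}$, where $B_j$ is the $j$-th Bernoulli number ($B_1=-\frac12$), and $r_n$ is the rational number $$r_n=\sum_{k=1}^{n+1}\frac{(-1)^{k+1}}{k!}\,b_{n-k}\,H_k,\qquad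 H_k=1+\frac12+\cdots+\frac1k .$$ In particular each $S_n$ is an exponential period over the field $\mathbb{Q}(t,e^{-t})$, that is, a convergent integral $\int_\eta f(t)\,dt$ of some $f\in\mathbb{Q}(t,e^{-t})$ along an open path $\eta$ in $\mathbb{C}$ that avoids the singularities of $f$ and whose two ends are singularities of $f$. Here, writing $f=P(t,e^{-t})/Q(t,e^{-t})$ with $P,Q\in\mathbb{Q}[X,Y]$ relatively prime, the singularities of $f$ are the zeros of $Q(t,e^{-t})$, together with $\infty$ unless $f$ is a rational function of $t$ alone that is regular at $\infty$. -/

import Mathlib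

open Filter Topology Asymptotics MeasureTheory

/-- `b k` is the coefficient of `t ^ k` in the Laurent expansion of `1 / (1 - e ^ (-t))` at `0`,
computed in the field of formal Laurent series over `ℚ`. -/
noncomputable def laurentB (k : ℤ) : ℚ :=
  HahnSeries.coeff
    (1 - ((PowerSeries.evalNegHom (PowerSeries.exp ℚ) : PowerSeries ℚ) : LaurentSeries ℚ))⁻¹ k

/-- The rational number `r_n = ∑_{k=1}^{n+1} (-1)^(k+1) / k! * b_{n-k} * H_k`. -/
noncomputable def ratR (n : ℕ) : ℚ :=
  ∑ k ∈ Finset.Icc 1 (n + 1),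
    (-1) ^ (k + 1) / (k.factorial : ℚ) * laurentB ((n : ℤ) - (k : ℤ)) * harmonic k

/-- `S` is the constant term of the asymptotic expansion, as the integer `s` tends to `+∞`,
`∑_{k=1}^s k^n log k = A(s) log s + B(s) + S + R(1/s)` with `A ∈ ℚ[s]`, `B ∈ s ℚ[s]` and
`R(1/s) ∈ (1/s) ℚ[[1/s]]`, where the formal series `R` is an asymptotic expansion in the sense
of Poincaré. -/
def IsStirlingRamanujanConstant (n : ℕ) (S : ℝ) : Prop :=
  ∃ (A B : Polynomial ℚ) (R : PowerSeries ℚ),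
    B.coeff 0 = 0 ∧ PowerSeries.constantCoeff R = 0 ∧
    ∀ N : ℕ,
      (fun s : ℕ =>
        (∑ k ∈ Finset.Icc 1 s, (k : ℝ) ^ n * Real.log (k : ℝ))
          - (Polynomial.aeval (s : ℝ) A * Real.log (s : ℝ) + Polynomial.aeval (s : ℝ) B + S
            + ∑ j ∈ Finset.range (N + 1), ((PowerSeries.coeff j R : ℚ) : ℝ) * ((s : ℝ)⁻¹) ^ j))
        =O[atTop] fun s : ℕ => ((s : ℝ)⁻¹) ^ (N + 1)

/-- The value `P(t, e^(-t))` of a polynomial `P` in two variables with rational coefficients. -/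
noncomputable def evalExp (P : MvPolynomial (Fin 2) ℚ) (t : ℂ) : ℂ :=
  MvPolynomial.aeval ![t, Complex.exp (-t)] P

/-- For `f = P(t, e^(-t)) / Q(t, e^(-t))` in lowest terms, the end of the path `γ` along the
filter `l` exists and is a singularity of `f`. The finite singularities are the zeros of the
denominator `Q(t, e^(-t))`. The point `∞` is a singularity unless `f` is a rational function
of `t` alone which is regular at `∞`. -/
def EndsAtSingularity (P Q : MvPolynomial (Fin 2) ℚ) (γ : ℝ → ℂ) (l : Filter ℝ) : Prop :=
  (∃ a : ℂ, Tendsto γ l (𝓝 a) ∧ evalExp Q a = 0) ∨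
  (Tendsto γ l (cocompact ℂ) ∧
    ¬ (P.degreeOf 1 = 0 ∧ Q.degreeOf 1 = 0 ∧ P.totalDegree ≤ Q.totalDegree))

/-- `ω` is an exponential period over the field `ℚ(t, e^(-t))`: a convergent integral
`ω = ∫_γ f(t) dt` of an element `f = P(t, e^(-t)) / Q(t, e^(-t))` of this field (in lowest terms)
over an open path `γ` that avoids the singularities of `f` and whose two ends are singularities
of `f`. -/
def IsExponentialPeriod (ω : ℂ) : Prop :=
  ∃ P Q : MvPolynomial (Fin 2) ℚ, Q ≠ 0 ∧ IsRelPrime P Q ∧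
    ∃ γ : ℝ → ℂ, ContDiff ℝ 1 γ ∧ (∀ u : ℝ, evalExp Q (γ u) ≠ 0) ∧
      EndsAtSingularity P Q γ atBot ∧ EndsAtSingularity P Q γ atTop ∧
      Tendsto
        (fun p : ℝ × ℝ =>
          ∫ u in p.1..p.2, evalExp P (γ u) / evalExp Q (γ u) * deriv γ u)
        (atBot ×ˢ atTop) (𝓝 ω)

/-! Integrating `e^(-xt) / t^(m+1)` over `t > 0`, after subtracting Taylor terms to make it
converge, produces `x^m (log x - H_m)` up to the factor `(-1)^(m+1) / m!` (`integral_expRem_div`).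
So `k^n log k` is an exponential integral plus a multiple of `k^n`, and summing over `k` brings in
`1 / (1 - e^(-t))`.

The sum is carried out by telescoping. Let `L(x)` be the Laplace transform of the Laurent remainder
of `1 / (1 - e^(-t))`, divided by `t^(n+1)`. As `(e^(-xt) - e^(-(x+1)t)) / (1 - e^(-t)) = e^(-xt)`,
the difference `L(x) - L(x+1)` is the `n`-th regularised integral at `x`, corrected by the
difference of the explicit function `toddLog`, of the form polynomial times `log x` plus polynomial
(`toddLaplace_sub`).

After summation over `1 ≤ k < s`, the end at `1` is the constant `S_n`. At the end `s`, `toddLog`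
contributes to `A` and `B`, while Watson's lemma for `L(s)` gives `R`. Since `toddLog` equals `-r_n`
at `1` and `∫ e^(-t) dt = 1`, the term `r_n t^(n+1)` in the integrand accounts for it. Uniqueness
compares the growth of polynomials and of `log`; the period statement follows from the substitution
`t = e^u`. -/

/-! ### Laurent coefficients and Bernoulli numbers -/

/-- The coefficients `bernoulli' m / m!` of the Todd series `X / (1 - exp (-X))`. -/
noncomputable def todd (m : ℕ) : ℚ := bernoulli' m / (m.factorial : ℚ)

lemma todd_eq (m : ℕ) : todd m = (-1) ^ m * bernoulli m / (m.factorial : ℚ) := by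
  rw [todd, bernoulli'_eq_bernoulli]

@[simp] lemma todd_zero : todd 0 = 1 := by simp [todd]

lemma toddSeries_mul_one_sub (A : Type*) [CommRing A] [Algebra ℚ A] :
    bernoulli'PowerSeries A * (1 - PowerSeries.evalNegHom (PowerSeries.exp A)) =
      PowerSeries.X := by
  have h := bernoulli'PowerSeries_mul_exp_sub_one A
  have h2 := PowerSeries.exp_mul_exp_neg_eq_one (A := A)
  calc bernoulli'PowerSeries A * (1 - PowerSeries.evalNegHom (PowerSeries.exp A))
      = bernoulli'PowerSeries A * (PowerSeries.exp A *
          PowerSeries.evalNegHom (PowerSeries.exp A)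
          - PowerSeries.evalNegHom (PowerSeries.exp A)) := by rw [h2]
    _ = (bernoulli'PowerSeries A * (PowerSeries.exp A - 1)) *
          PowerSeries.evalNegHom (PowerSeries.exp A) := by ring
    _ = PowerSeries.X * (PowerSeries.exp A *
          PowerSeries.evalNegHom (PowerSeries.exp A)) := by rw [h]; ring
    _ = PowerSeries.X := by rw [h2, mul_one]

lemma laurentB_sub_one (m : ℕ) : laurentB ((m : ℤ) - 1) = todd m := by
  have h := congrArg (fun f : PowerSeries ℚ => (f : LaurentSeries ℚ)) (toddSeries_mul_one_sub ℚ)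
  simp only [PowerSeries.coe_mul, PowerSeries.coe_sub, PowerSeries.coe_one,
    PowerSeries.coe_X] at h
  have key : (1 - ((PowerSeries.evalNegHom (PowerSeries.exp ℚ) : PowerSeries ℚ) :
      LaurentSeries ℚ))⁻¹ =
      ((bernoulli'PowerSeries ℚ : PowerSeries ℚ) : LaurentSeries ℚ) *
        HahnSeries.single (-1 : ℤ) (1 : ℚ) := by
    apply inv_eq_of_mul_eq_one_right
    rw [← mul_assoc, mul_comm (1 - _), h, HahnSeries.single_mul_single]
    simp
  rw [laurentB, key, sub_eq_add_neg, HahnSeries.coeff_mul_single_add, mul_one]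
  simp [bernoulli'PowerSeries, todd]

/-- For even `m > 0` the left side times `(2π)^m` is `2 ζ(m) ≤ 2 ζ(2) = π² / 3 < 4`. The case `m =
1` amounts to `π ≤ 4`, and the other odd coefficients vanish. -/
lemma abs_todd_le (m : ℕ) : |(todd m : ℝ)| ≤ 4 * (2 * Real.pi)⁻¹ ^ m := by
  have hpi := Real.pi_pos
  rcases Nat.even_or_odd' m with ⟨k, rfl | rfl⟩
  · rcases eq_or_ne k 0 with rfl | hk
    · simp
    have h := hasSum_zeta_nat hk
    have h2 : ∑' n : ℕ, 1 / (n : ℝ) ^ (2 * k) ≤ ∑' n : ℕ, 1 / (n : ℝ) ^ 2 := by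
      refine Summable.tsum_le_tsum (fun n => ?_) h.summable hasSum_zeta_two.summable
      rcases Nat.eq_zero_or_pos n with rfl | hn
      · simp [hk]
      · have : (1 : ℝ) ≤ n := by exact_mod_cast hn
        exact one_div_le_one_div_of_le (by positivity) (pow_le_pow_right₀ this (by omega))
    rw [h.tsum_eq, hasSum_zeta_two.tsum_eq] at h2
    have h3 : (0 : ℝ) ≤ (-1 : ℝ) ^ (k + 1) * (2 : ℝ) ^ (2 * k - 1) * Real.pi ^ (2 * k) *
        bernoulli (2 * k) / (2 * k).factorial := by
      rw [← h.tsum_eq]; positivity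
    have h4 : |(todd (2 * k) : ℝ)| * (2 * Real.pi) ^ (2 * k) =
        2 * ((-1 : ℝ) ^ (k + 1) * (2 : ℝ) ^ (2 * k - 1) * Real.pi ^ (2 * k) *
        bernoulli (2 * k) / (2 * k).factorial) := by
      rw [← abs_of_nonneg h3, todd_eq]
      push_cast
      have e2 : (2 : ℝ) ^ (2 * k) = 2 * 2 ^ (2 * k - 1) := by
        rw [← pow_succ']; congr 1; omega
      simp only [abs_div, abs_mul, abs_pow, abs_neg, abs_one, one_pow, one_mul, Nat.abs_cast,
        abs_of_pos hpi, mul_pow, e2, Nat.abs_ofNat]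
      ring
    rw [inv_pow, ← div_eq_mul_inv, le_div_iff₀ (by positivity), h4]
    have : Real.pi ^ 2 ≤ 12 := by nlinarith [Real.pi_lt_d2]
    linarith
  · rcases eq_or_ne k 0 with rfl | hk
    · norm_num [todd, abs_of_pos]
      have : (4 : ℝ)⁻¹ ≤ Real.pi⁻¹ := inv_anti₀ hpi Real.pi_lt_four.le
      linarith
    · rw [todd, bernoulli'_eq_zero_of_odd ⟨k, rfl⟩ (by omega)]
      simp only [zero_div, Rat.cast_zero, abs_zero]
      positivity

lemma summable_norm_todd_mul_pow {t : ℂ} (ht : ‖t‖ < 2 * Real.pi) :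
    Summable (fun m : ℕ => ‖(todd m : ℂ) * t ^ m‖) := by
  have hpi := Real.pi_pos
  refine Summable.of_nonneg_of_le (fun m => norm_nonneg _) (fun m => ?_)
    ((summable_geometric_of_lt_one (r := ‖t‖ / (2 * Real.pi)) (by positivity)
      ((div_lt_one (by positivity)).2 ht)).mul_left 4)
  have := abs_todd_le m
  rw [norm_mul, norm_pow, div_pow, div_eq_mul_inv, ← inv_pow, mul_comm (‖t‖ ^ m), ← mul_assoc]
  have e : ‖(todd m : ℂ)‖ = |(todd m : ℝ)| := by
    rw [← Complex.ofReal_ratCast, Complex.norm_real, Real.norm_eq_abs]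
  rw [e]
  gcongr

lemma hasSum_one_sub_exp_neg (t : ℂ) :
    HasSum (fun m : ℕ => PowerSeries.coeff m
      (1 - PowerSeries.evalNegHom (PowerSeries.exp ℂ)) * t ^ m) (1 - Complex.exp (-t)) ∧
    Summable (fun m : ℕ => ‖PowerSeries.coeff m
      (1 - PowerSeries.evalNegHom (PowerSeries.exp ℂ)) * t ^ m‖) := by
  have h : ∀ m : ℕ, PowerSeries.coeff m (1 - PowerSeries.evalNegHom (PowerSeries.exp ℂ)) * t ^ m
      = (if m = 0 then 1 else 0) - (-t) ^ m / (m.factorial : ℂ) := by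
    intro m
    rw [map_sub, PowerSeries.coeff_one, PowerSeries.evalNegHom, PowerSeries.coeff_rescale,
      PowerSeries.coeff_exp, neg_pow t]
    split_ifs with hm
    · simp [hm]
    · simp; ring
  have h2 : HasSum (fun m : ℕ => (-t) ^ m / (m.factorial : ℂ)) (Complex.exp (-t)) := by
    rw [Complex.exp_eq_exp_ℂ]
    exact NormedSpace.expSeries_div_hasSum_exp (-t)
  simp only [h]
  have h3 := hasSum_ite_eq (0 : ℕ) (1 : ℂ)
  exact ⟨h3.sub h2, (h3.summable.sub h2.summable).norm⟩

/-- Both series converge absolutely, so the formal identity `toddSeries_mul_one_sub` passes to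
values through the Cauchy product. -/
lemma todd_tsum_mul {t : ℂ} (ht : ‖t‖ < 2 * Real.pi) :
    (∑' m : ℕ, (todd m : ℂ) * t ^ m) * (1 - Complex.exp (-t)) = t := by
  obtain ⟨h1, h2⟩ := hasSum_one_sub_exp_neg t
  rw [← h1.tsum_eq, tsum_mul_tsum_eq_tsum_sum_antidiagonal_of_summable_norm
    (summable_norm_todd_mul_pow ht) h2]
  have : ∀ n : ℕ, ∑ kl ∈ Finset.HasAntidiagonal.antidiagonal n, (todd kl.1 : ℂ) * t ^ kl.1 *
      (PowerSeries.coeff kl.2 (1 - PowerSeries.evalNegHom (PowerSeries.exp ℂ)) * t ^ kl.2)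
      = if n = 1 then t else 0 := by
    intro n
    have := congrArg (PowerSeries.coeff n) (toddSeries_mul_one_sub ℂ)
    rw [PowerSeries.coeff_mul, PowerSeries.coeff_X] at this
    have e : (if n = 1 then t else 0) = (if n = 1 then 1 else 0) * t ^ n := by
      split_ifs with h <;> simp [h]
    rw [e, ← this, Finset.sum_mul]
    refine Finset.sum_congr rfl fun kl hkl => ?_
    rw [← Finset.HasAntidiagonal.mem_antidiagonal.1 hkl, pow_add]
    simp only [bernoulli'PowerSeries, PowerSeries.coeff_mk, todd, eq_ratCast]
    ring
  rw [tsum_congr this, tsum_ite_eq]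

lemma hasSum_laurentB {t : ℂ} (ht0 : t ≠ 0) (ht : ‖t‖ < 2 * Real.pi) :
    HasSum (fun m : ℕ => (laurentB ((m : ℤ) - 1) : ℂ) * t ^ ((m : ℤ) - 1))
      (1 / (1 - Complex.exp (-t))) := by
  have h := todd_tsum_mul ht
  have hne : 1 - Complex.exp (-t) ≠ 0 := fun h0 => ht0 (by rw [← h, h0, mul_zero])
  have hs := ((summable_norm_todd_mul_pow ht).of_norm.hasSum).mul_left t⁻¹
  have e : ∀ m : ℕ, (laurentB ((m : ℤ) - 1) : ℂ) * t ^ ((m : ℤ) - 1) =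
      t⁻¹ * ((todd m : ℂ) * t ^ m) := by
    intro m
    rw [laurentB_sub_one, zpow_sub_one₀ ht0, zpow_natCast]; ring
  have e2 : 1 / (1 - Complex.exp (-t)) = t⁻¹ * ∑' m : ℕ, (todd m : ℂ) * t ^ m := by
    rw [eq_div_of_mul_eq hne h]; field_simp
  simpa only [e, e2] using hs

/-! ### Regularised exponential integrals -/

lemma integrableOn_Ioi_zero_of_isBigO {f : ℝ → ℝ} (hc : ContinuousOn f (Set.Ioi 0))
    (h0 : f =O[𝓝[>] 0] fun _ => (1 : ℝ)) (htop : f =O[atTop] fun t => t ^ (-2 : ℝ)) :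
    IntegrableOn f (Set.Ioi 0) := by
  -- The integral is the Mellin transform at `1`, inside the strip `0 < s < 2` given by the two
  -- bounds.
  have h := mellin_convergent_of_isBigO_scalar (s := 1) (a := 2) (b := 0)
    (hc.locallyIntegrableOn measurableSet_Ioi) htop (by norm_num)
    (by simpa using h0) (by norm_num)
  simpa using h

/-- The function `exp (-x t)` minus its Taylor polynomial in `t` of degree `m`, where the top term
of this polynomial is multiplied by `exp (-t)` to be integrable against `t ^ (-m - 1)` at `∞`. -/
noncomputable def expRem (m : ℕ) (x t : ℝ) : ℝ :=
  Real.exp (-(x * t)) - ∑ j ∈ Finset.range m, (-(x * t)) ^ j / (j.factorial : ℝ)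
    - (-(x * t)) ^ m / (m.factorial : ℝ) * Real.exp (-t)

lemma hasDerivAt_taylor_exp (m : ℕ) (x t : ℝ) :
    HasDerivAt (fun t => ∑ j ∈ Finset.range (m + 1), (-(x * t)) ^ j / (j.factorial : ℝ))
      (-x * ∑ j ∈ Finset.range m, (-(x * t)) ^ j / (j.factorial : ℝ)) t := by
  induction m with
  | zero => simpa using hasDerivAt_const t (1 : ℝ)
  | succ m ih =>
    have hlin : HasDerivAt (fun t : ℝ => -(x * t)) (-x) t := by
      simpa using ((hasDerivAt_id' t).const_mul x).fun_neg
    have h := ih.fun_add ((hlin.fun_pow (m + 1)).div_const ((m + 1).factorial : ℝ))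
    simp only [Finset.sum_range_succ _ (m + 1)]
    refine h.congr_deriv ?_
    rw [Finset.sum_range_succ, Nat.factorial_succ]
    push_cast
    have : (m.factorial : ℝ) ≠ 0 := by positivity
    have : (m + 1 : ℝ) ≠ 0 := by positivity
    field_simp
    ring

lemma hasDerivAt_expRem_succ (m : ℕ) (x t : ℝ) :
    HasDerivAt (expRem (m + 1) x)
      (-x * expRem m x t + (-(x * t)) ^ (m + 1) / ((m + 1).factorial : ℝ) * Real.exp (-t)) t := by
  have hlin : HasDerivAt (fun t : ℝ => -(x * t)) (-x) t := by
    simpa using ((hasDerivAt_id' t).const_mul x).fun_neg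
  have h := (hlin.exp.sub (hasDerivAt_taylor_exp m x t)).sub
    (((hlin.pow (m + 1)).div_const ((m + 1).factorial : ℝ)).mul (hasDerivAt_neg t).exp)
  refine h.congr_deriv ?_
  rw [expRem, Nat.factorial_succ]
  push_cast
  have : (m.factorial : ℝ) ≠ 0 := by positivity
  have : (m + 1 : ℝ) ≠ 0 := by positivity
  simp only [Pi.pow_apply]
  field_simp
  ring

lemma continuous_expRem (m : ℕ) (x : ℝ) : Continuous (expRem m x) := by
  unfold expRem
  fun_prop

/-- Replacing `e^(-t)` by `1` in the top term turns `expRem` into a genuine Taylor remainder, at the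
cost of `t^m (e^(-t) - 1)`, which has the same order. -/
lemma expRem_isBigO_zero (m : ℕ) (x : ℝ) :
    expRem m x =O[𝓝 0] fun t => t ^ (m + 1) := by
  have hx : Tendsto (fun t : ℝ => -(x * t)) (𝓝 0) (𝓝 0) := by
    have : Continuous fun t : ℝ => -(x * t) := by fun_prop
    simpa using this.tendsto 0
  have hO : (fun t : ℝ => -(x * t)) =O[𝓝 0] fun t => t := by
    simpa [neg_mul] using isBigO_const_mul_self (-x) (fun t : ℝ => t) (𝓝 0)
  have h1 : (fun t : ℝ => Real.exp (-(x * t)) - ∑ j ∈ Finset.range (m + 1),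
      (-(x * t)) ^ j / (j.factorial : ℝ)) =O[𝓝 0] fun t => t ^ (m + 1) :=
    ((Real.exp_sub_sum_range_isBigO_pow (m + 1)).comp_tendsto hx).trans (hO.pow (m + 1))
  have h2 : (fun t : ℝ => Real.exp (-t) - 1) =O[𝓝 0] fun t => t := by
    have := (Real.exp_sub_sum_range_isBigO_pow 1).comp_tendsto
      (show Tendsto (fun t : ℝ => -t) (𝓝 0) (𝓝 0) by simpa using (continuous_neg.tendsto (0 : ℝ)))
    refine (IsBigO.trans (by simpa [Function.comp_def] using this) ?_ :
      (fun t : ℝ => Real.exp (-t) - 1) =O[𝓝 0] fun t => t)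
    exact (isBigO_refl (fun t : ℝ => t) (𝓝 0)).neg_left
  have h3 : (fun t : ℝ => (m.factorial : ℝ)⁻¹ * (-(x * t)) ^ m * (Real.exp (-t) - 1))
      =O[𝓝 0] fun t => t ^ (m + 1) := by
    simp only [pow_succ]
    exact ((hO.pow m).const_mul_left _).mul h2
  refine (h1.sub h3).congr_left fun t => ?_
  rw [expRem, Finset.sum_range_succ]
  ring

/-- The damped top term leaves a polynomial of degree below `m`. The exponent is real because `m =
0` must give decay `t^(-1)`. -/
lemma expRem_isBigO_atTop (m : ℕ) {x : ℝ} (hx : 0 < x) :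
    expRem m x =O[atTop] fun t => t ^ ((m : ℝ) - 1) := by
  have h1 : (fun t : ℝ => Real.exp (-(x * t))) =O[atTop] fun t => t ^ ((m : ℝ) - 1) := by
    simpa [neg_mul] using (isLittleO_exp_neg_mul_rpow_atTop hx ((m : ℝ) - 1)).isBigO
  have h2 : (fun t : ℝ => ∑ j ∈ Finset.range m, (-(x * t)) ^ j / (j.factorial : ℝ))
      =O[atTop] fun t => t ^ ((m : ℝ) - 1) := by
    refine IsBigO.fun_sum fun j hj => ?_
    have hjm : (j : ℝ) ≤ (m : ℝ) - 1 := by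
      have : j + 1 ≤ m := Finset.mem_range.1 hj
      have : ((j + 1 : ℕ) : ℝ) ≤ m := by exact_mod_cast this
      push_cast at this; linarith
    have : (fun t : ℝ => t ^ j) =O[atTop] fun t => t ^ ((m : ℝ) - 1) := by
      refine IsBigO.of_bound 1 ?_
      filter_upwards [eventually_ge_atTop 1] with t ht
      rw [one_mul, Real.norm_of_nonneg (by positivity), Real.norm_of_nonneg (by positivity),
        ← Real.rpow_natCast]
      exact Real.rpow_le_rpow_of_exponent_le ht hjm
    refine (this.const_mul_left ((-x) ^ j / (j.factorial : ℝ))).congr_left fun t => ?_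
    rw [← neg_mul, mul_pow]; ring
  have h3 : (fun t : ℝ => (-(x * t)) ^ m / (m.factorial : ℝ) * Real.exp (-t))
      =O[atTop] fun t => t ^ ((m : ℝ) - 1) := by
    have h4 : (fun t : ℝ => Real.exp (-t)) =O[atTop] fun t => t ^ (-1 : ℝ) := by
      simpa [neg_mul] using (isLittleO_exp_neg_mul_rpow_atTop one_pos (-1 : ℝ)).isBigO
    have h5 := ((isBigO_refl (fun t : ℝ => t ^ m) atTop).const_mul_left
      ((-x) ^ m / (m.factorial : ℝ))).mul h4
    refine (h5.congr_left fun t => ?_).congr' EventuallyEq.rfl ?_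
    · rw [← neg_mul, mul_pow]; ring
    · filter_upwards [eventually_gt_atTop 0] with t ht
      rw [← Real.rpow_natCast, ← Real.rpow_add ht, sub_eq_add_neg]
  exact (h1.sub h2).sub h3

lemma expRem_div_isBigO_zero (m : ℕ) (x : ℝ) :
    (fun t => expRem m x t / t ^ (m + 1)) =O[𝓝[>] 0] fun _ => (1 : ℝ) := by
  have h := ((expRem_isBigO_zero m x).mono (nhdsWithin_le_nhds (s := Set.Ioi 0))).mul
    (isBigO_refl (fun t : ℝ => (t ^ (m + 1))⁻¹) (𝓝[>] 0))
  refine h.congr' EventuallyEq.rfl ?_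
  filter_upwards [self_mem_nhdsWithin] with t ht
  exact mul_inv_cancel₀ (pow_ne_zero _ (ne_of_gt ht))

lemma expRem_div_isBigO_atTop (m : ℕ) {x : ℝ} (hx : 0 < x) :
    (fun t => expRem m x t / t ^ (m + 1)) =O[atTop] fun t => t ^ (-2 : ℝ) := by
  have h := (expRem_isBigO_atTop m hx).mul
    (isBigO_refl (fun t : ℝ => (t ^ (m + 1))⁻¹) atTop)
  refine h.congr' EventuallyEq.rfl ?_
  filter_upwards [eventually_gt_atTop 0] with t ht
  rw [← Real.rpow_natCast, ← Real.rpow_neg ht.le, ← Real.rpow_add ht]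
  congr 1
  push_cast
  ring

lemma integrableOn_expRem_div (m : ℕ) {x : ℝ} (hx : 0 < x) :
    IntegrableOn (fun t => expRem m x t / t ^ (m + 1)) (Set.Ioi 0) :=
  integrableOn_Ioi_zero_of_isBigO
    ((continuous_expRem m x).continuousOn.div (by fun_prop) fun t ht => pow_ne_zero _ (ne_of_gt ht))
    (expRem_div_isBigO_zero m x) (expRem_div_isBigO_atTop m hx)

lemma integral_expRem_zero_div {x : ℝ} (hx : 0 < x) :
    ∫ t in Set.Ioi 0, expRem 0 x t / t ^ 1 = -Real.log x := by
  have e : ∀ t : ℝ, expRem 0 x t / t ^ 1 =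
      t⁻¹ • (Real.exp (-(x * t)) - Real.exp (-(1 * t))) := by
    intro t
    simp [expRem, div_eq_inv_mul]
  have hint := integrableOn_expRem_div 0 hx
  simp only [zero_add, e] at hint ⊢
  have hc : Continuous fun t : ℝ => Real.exp (-t) := by fun_prop
  rw [Frullani.integral_Ioi_eq (f := fun t => Real.exp (-t)) (L := 1) (R := 0)
    (hc.continuousOn.locallyIntegrableOn measurableSet_Ioi) hx one_pos
    ?_ ?_ hint]
  · simp
  · exact tendsto_nhdsWithin_of_tendsto_nhds (by simpa using hc.tendsto 0)
  · exact Real.tendsto_exp_neg_atTop_nhds_zero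

/-- Integration by parts: the derivative of `expRem (m + 1) x t / t^(m+1)` has integral zero.
Differentiating the damping factor adds a multiple of `∫ e^(-t) dt = 1`; this is the source of the
harmonic numbers. -/
lemma integral_expRem_succ_div (m : ℕ) {x : ℝ} (hx : 0 < x) :
    (m + 1 : ℝ) * ∫ t in Set.Ioi 0, expRem (m + 1) x t / t ^ (m + 2) =
      -x * (∫ t in Set.Ioi 0, expRem m x t / t ^ (m + 1))
        + (-x) ^ (m + 1) / ((m + 1).factorial : ℝ) := by
  have hi1 := integrableOn_expRem_div (m + 1) hx
  have hi0 := integrableOn_expRem_div m hx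
  have hie := integrableOn_exp_neg_Ioi 0
  set G : ℝ → ℝ := fun t => expRem (m + 1) x t / t ^ (m + 1) with hG
  have hd : ∀ t ∈ Set.Ioi (0 : ℝ), HasDerivAt G
      (-x * (expRem m x t / t ^ (m + 1)) + (-x) ^ (m + 1) / ((m + 1).factorial : ℝ) * Real.exp (-t)
        - (m + 1) * (expRem (m + 1) x t / t ^ (m + 2))) t := by
    intro t ht
    have ht0 : t ≠ 0 := ne_of_gt ht
    have h := (hasDerivAt_expRem_succ m x t).div (hasDerivAt_pow (m + 1) t) (pow_ne_zero _ ht0)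
    refine h.congr_deriv ?_
    have : ((m + 1).factorial : ℝ) ≠ 0 := by positivity
    rw [← neg_mul, mul_pow]
    push_cast
    field_simp
    ring
  have hGt : ∀ t : ℝ, t ≠ 0 → G t = expRem (m + 1) x t / t ^ (m + 1 + 1) * t := by
    intro t ht
    simp only [hG]
    field_simp
    ring
  have h0 : Tendsto G (𝓝[>] 0) (𝓝 0) := by
    have h := (expRem_div_isBigO_zero (m + 1) x).mul (isBigO_refl (fun t : ℝ => t) (𝓝[>] 0))
    refine IsBigO.trans_tendsto (h.congr' ?_ EventuallyEq.rfl) ?_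
    · filter_upwards [self_mem_nhdsWithin] with t ht
      exact (hGt t (ne_of_gt ht)).symm
    · simpa using (tendsto_nhdsWithin_of_tendsto_nhds tendsto_id :
        Tendsto (fun t : ℝ => t) (𝓝[>] 0) (𝓝 0))
  have htop : Tendsto G atTop (𝓝 0) := by
    have h := (expRem_div_isBigO_atTop (m + 1) hx).mul (isBigO_refl (fun t : ℝ => t) atTop)
    refine IsBigO.trans_tendsto (h.congr' (f₂ := G) (g₂ := fun t : ℝ => t⁻¹) ?_ ?_)
      tendsto_inv_atTop_zero
    · filter_upwards [eventually_gt_atTop 0] with t ht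
      exact (hGt t (ne_of_gt ht)).symm
    · filter_upwards [eventually_gt_atTop 0] with t ht
      rw [Real.rpow_neg ht.le, Real.rpow_two]
      field_simp
  -- Division by zero gives `0`, which is also the limit, so `G` is right-continuous at `0`.
  have hG0 : G 0 = 0 := by simp [hG]
  have hi : IntegrableOn (fun t => -x * (expRem m x t / t ^ (m + 1)) +
      (-x) ^ (m + 1) / ((m + 1).factorial : ℝ) * Real.exp (-t)) (Set.Ioi 0) :=
    (hi0.const_mul _).add (hie.const_mul _)
  have key := integral_Ioi_of_hasDerivAt_of_tendsto (f := G) (a := 0) (m := 0)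
    (by rw [← continuousWithinAt_Ioi_iff_Ici, ContinuousWithinAt, hG0]; exact h0) hd
    (hi.sub (hi1.const_mul _)) htop
  rw [integral_sub hi (hi1.const_mul _),
    integral_add (hi0.const_mul _) (hie.const_mul _), integral_const_mul, integral_const_mul,
    integral_const_mul, integral_exp_neg_Ioi_zero, hG0] at key
  linarith

lemma integral_expRem_div (m : ℕ) {x : ℝ} (hx : 0 < x) :
    ∫ t in Set.Ioi 0, expRem m x t / t ^ (m + 1) =
      (-1) ^ (m + 1) * x ^ m / (m.factorial : ℝ) * (Real.log x - (harmonic m : ℝ)) := by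
  induction m with
  | zero => simpa using integral_expRem_zero_div hx
  | succ m ih =>
    have h := integral_expRem_succ_div m hx
    have hm : (m + 1 : ℝ) ≠ 0 := by positivity
    have hf : (m.factorial : ℝ) ≠ 0 := by positivity
    rw [ih] at h
    apply mul_left_cancel₀ hm
    rw [h, harmonic_succ, Nat.factorial_succ]
    push_cast
    rw [neg_pow x]
    field_simp
    ring

/-! ### Laurent remainder and Watson's lemma -/

/-- The remainder of order `N` in the Laurent expansion of `1 / (1 - exp (-t))`. -/
noncomputable def toddRem (N : ℕ) (t : ℝ) : ℝ :=
  1 / (1 - Real.exp (-t)) - ∑ m ∈ Finset.range (N + 1), (todd m : ℝ) * t ^ m / t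

lemma one_sub_exp_neg_pos {t : ℝ} (ht : 0 < t) : 0 < 1 - Real.exp (-t) := by
  simpa using ht

lemma continuousOn_toddRem (N : ℕ) : ContinuousOn (toddRem N) (Set.Ioi 0) := by
  unfold toddRem
  refine ContinuousOn.sub (ContinuousOn.div (by fun_prop) (by fun_prop) fun t ht =>
    (one_sub_exp_neg_pos ht).ne') ?_
  exact continuousOn_finsetSum _ fun m _ => ContinuousOn.div (by fun_prop) (by fun_prop)
    fun t ht => ne_of_gt ht

lemma hasSum_todd_mul_pow {t : ℝ} (ht0 : 0 < t) (ht : t < 2 * Real.pi) :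
    HasSum (fun m : ℕ => (todd m : ℝ) * t ^ m) (t / (1 - Real.exp (-t))) := by
  have hn : ‖(t : ℂ)‖ < 2 * Real.pi := by
    rwa [Complex.norm_real, Real.norm_of_nonneg ht0.le]
  have h := todd_tsum_mul hn
  have hs := (summable_norm_todd_mul_pow hn).of_norm.hasSum
  have hne : (1 : ℂ) - Complex.exp (-t) ≠ 0 := by
    exact_mod_cast (one_sub_exp_neg_pos ht0).ne'
  rw [eq_div_of_mul_eq hne h] at hs
  exact_mod_cast hs

/-- For `t ≤ 1 < 2π` the remainder is the tail of the convergent series; for `t ≥ 1` every term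
separately is bounded by a multiple of `t^N`. -/
lemma abs_toddRem_le (N : ℕ) : ∃ C : ℝ, 0 ≤ C ∧ ∀ t : ℝ, 0 < t → |toddRem N t| ≤ C * t ^ N := by
  have hs : Summable fun m : ℕ => |(todd m : ℝ)| := by
    have h := summable_norm_todd_mul_pow (t := 1) (by simp; linarith [Real.pi_gt_three])
    refine h.congr fun m => ?_
    rw [one_pow, mul_one, ← Complex.ofReal_ratCast, Complex.norm_real, Real.norm_eq_abs]
  have hs' := (summable_nat_add_iff (N + 1)).2 hs
  have hC0 : 0 ≤ ∑' m : ℕ, |(todd (m + (N + 1)) : ℝ)| := tsum_nonneg fun _ => abs_nonneg _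
  have hC1 : 0 < 1 / (1 - Real.exp (-1)) := one_div_pos.2 (one_sub_exp_neg_pos one_pos)
  have hC2 : 0 ≤ ∑ m ∈ Finset.range (N + 1), |(todd m : ℝ)| :=
    Finset.sum_nonneg fun _ _ => abs_nonneg _
  refine ⟨(∑' m : ℕ, |(todd (m + (N + 1)) : ℝ)|) + 1 / (1 - Real.exp (-1)) +
    ∑ m ∈ Finset.range (N + 1), |(todd m : ℝ)|, by positivity, fun t ht => ?_⟩
  rcases le_total t 1 with h1 | h1
  · have h := (hasSum_nat_add_iff' (N + 1)).2
      (hasSum_todd_mul_pow ht (by linarith [Real.pi_gt_three]))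
    have e : t / (1 - Real.exp (-t)) - ∑ m ∈ Finset.range (N + 1), (todd m : ℝ) * t ^ m =
        t * toddRem N t := by
      rw [toddRem, mul_sub, Finset.mul_sum]
      congr 1
      · ring
      · exact Finset.sum_congr rfl fun m _ => by field_simp
    rw [e] at h
    have h2 : |t * toddRem N t| ≤ (∑' m : ℕ, |(todd (m + (N + 1)) : ℝ)|) * t ^ (N + 1) := by
      rw [← h.tsum_eq, ← Real.norm_eq_abs, ← tsum_mul_right]
      refine tsum_of_norm_bounded (hs'.mul_right _).hasSum fun m => ?_
      rw [norm_mul, Real.norm_eq_abs, Real.norm_of_nonneg (by positivity)]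
      exact mul_le_mul_of_nonneg_left (pow_le_pow_of_le_one ht.le h1 (by omega)) (abs_nonneg _)
    rw [abs_mul, abs_of_pos ht, pow_succ', mul_left_comm] at h2
    have h3 := le_of_mul_le_mul_left h2 ht
    refine h3.trans (mul_le_mul_of_nonneg_right ?_ (by positivity))
    linarith
  · have ht1 : 1 ≤ t ^ N := one_le_pow₀ h1
    have hA : |1 / (1 - Real.exp (-t))| ≤ 1 / (1 - Real.exp (-1)) * t ^ N := by
      rw [abs_of_pos (one_div_pos.2 (one_sub_exp_neg_pos ht))]
      refine le_trans ?_ (le_mul_of_one_le_right hC1.le ht1)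
      refine one_div_le_one_div_of_le (one_sub_exp_neg_pos one_pos) ?_
      have := Real.exp_le_exp.2 (neg_le_neg h1)
      linarith
    have hB : |∑ m ∈ Finset.range (N + 1), (todd m : ℝ) * t ^ m / t| ≤
        (∑ m ∈ Finset.range (N + 1), |(todd m : ℝ)|) * t ^ N := by
      rw [Finset.sum_mul]
      refine (Finset.abs_sum_le_sum_abs _ _).trans (Finset.sum_le_sum fun m hm => ?_)
      rw [mul_div_assoc, abs_mul, abs_of_nonneg (by positivity : 0 ≤ t ^ m / t)]
      refine mul_le_mul_of_nonneg_left ?_ (abs_nonneg _)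
      rw [div_le_iff₀ ht, ← pow_succ]
      exact pow_le_pow_right₀ h1 (Finset.mem_range.1 hm).le
    have := abs_sub (1 / (1 - Real.exp (-t)))
      (∑ m ∈ Finset.range (N + 1), (todd m : ℝ) * t ^ m / t)
    rw [toddRem, add_mul, add_mul]
    have : 0 ≤ (∑' m : ℕ, |(todd (m + (N + 1)) : ℝ)|) * t ^ N := by positivity
    linarith

lemma integrableOn_pow_mul_exp_neg (k : ℕ) {x : ℝ} (hx : 0 < x) :
    IntegrableOn (fun t : ℝ => t ^ k * Real.exp (-(x * t))) (Set.Ioi 0) := by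
  have h := integrableOn_rpow_mul_exp_neg_mul_rpow (p := 1) (s := k) (b := x)
    (by have : (0 : ℝ) ≤ k := k.cast_nonneg
        linarith) one_pos hx
  simpa [neg_mul] using h

lemma integral_pow_mul_exp_neg (k : ℕ) {x : ℝ} (hx : 0 < x) :
    ∫ t in Set.Ioi (0 : ℝ), t ^ k * Real.exp (-(x * t)) = k.factorial * x⁻¹ ^ (k + 1) := by
  have h := Real.integral_rpow_mul_exp_neg_mul_Ioi (a := k + 1) (r := x) (by positivity) hx
  rw [Real.Gamma_nat_eq_factorial, one_div] at h
  simp only [add_sub_cancel_right, Real.rpow_natCast] at h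
  rw [h, mul_comm]
  congr 1
  exact_mod_cast Real.rpow_natCast x⁻¹ (k + 1)

lemma abs_toddRem_div_mul_exp_le {n N : ℕ} {C t : ℝ} (x : ℝ) (ht : 0 < t)
    (hC : |toddRem (n + N) t| ≤ C * t ^ (n + N)) :
    |toddRem (n + N) t / t ^ n * Real.exp (-(x * t))| ≤
      C * (t ^ N * Real.exp (-(x * t))) := by
  rw [abs_mul, Real.abs_exp, abs_div, abs_of_pos (pow_pos ht n), ← mul_assoc]
  refine mul_le_mul_of_nonneg_right ?_ (Real.exp_pos _).le
  rw [div_le_iff₀ (by positivity)]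
  calc _ ≤ _ := hC
    _ = _ := by ring

lemma integrableOn_toddRem_div (n N : ℕ) {x : ℝ} (hx : 0 < x) :
    IntegrableOn (fun t => toddRem (n + N) t / t ^ n * Real.exp (-(x * t))) (Set.Ioi 0) := by
  obtain ⟨C, hC0, hC⟩ := abs_toddRem_le (n + N)
  have hc : ContinuousOn (fun t => toddRem (n + N) t / t ^ n * Real.exp (-(x * t)))
      (Set.Ioi 0) :=
    ((continuousOn_toddRem _).div (by fun_prop) fun t ht => pow_ne_zero _ (ne_of_gt ht)).mul
      (by fun_prop)
  refine Integrable.mono' ((integrableOn_pow_mul_exp_neg N hx).const_mul C)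
    (hc.aestronglyMeasurable measurableSet_Ioi) ?_
  filter_upwards [ae_restrict_mem measurableSet_Ioi] with t ht
  rw [Real.norm_eq_abs]
  exact abs_toddRem_div_mul_exp_le x ht (hC t ht)

lemma integral_toddRem_div_isBigO (n N : ℕ) :
    (fun x : ℝ => ∫ t in Set.Ioi 0, toddRem (n + N) t / t ^ n * Real.exp (-(x * t)))
      =O[atTop] fun x => x⁻¹ ^ (N + 1) := by
  obtain ⟨C, hC0, hC⟩ := abs_toddRem_le (n + N)
  refine IsBigO.of_bound (C * N.factorial) ?_
  filter_upwards [eventually_gt_atTop 0] with x hx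
  have h := norm_integral_le_of_norm_le (μ := volume.restrict (Set.Ioi 0))
    (f := fun t => toddRem (n + N) t / t ^ n * Real.exp (-(x * t)))
    ((integrableOn_pow_mul_exp_neg N hx).const_mul C) (by
      filter_upwards [ae_restrict_mem measurableSet_Ioi] with t ht
      rw [Real.norm_eq_abs]
      exact abs_toddRem_div_mul_exp_le x ht (hC t ht))
  rw [integral_const_mul, integral_pow_mul_exp_neg N hx] at h
  rw [Real.norm_of_nonneg (by positivity : 0 ≤ x⁻¹ ^ (N + 1))]
  linarith

/-- The Laplace transform of `toddRem (n + 1) t / t ^ (n + 1)`. -/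
noncomputable def toddLaplace (n : ℕ) (x : ℝ) : ℝ :=
  ∫ t in Set.Ioi 0, toddRem (n + 1) t / t ^ (n + 1) * Real.exp (-(x * t))

lemma toddRem_div_eq (n N : ℕ) {t : ℝ} (ht : 0 < t) :
    toddRem (n + 1) t / t ^ (n + 1) =
      ∑ j ∈ Finset.range N, (todd (n + 2 + j) : ℝ) * t ^ j +
        toddRem (n + 1 + N) t / t ^ (n + 1) := by
  have h : toddRem (n + 1) t = toddRem (n + 1 + N) t +
      ∑ j ∈ Finset.range N, (todd (n + 2 + j) : ℝ) * t ^ (n + 2 + j) / t := by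
    have : n + 1 + N + 1 = n + 1 + 1 + N := by ring
    rw [toddRem, toddRem, this, Finset.sum_range_add _ (n + 1 + 1)]
    ring
  rw [h, add_div, add_comm, Finset.sum_div]
  congr 1
  refine Finset.sum_congr rfl fun j _ => ?_
  have : t ≠ 0 := ht.ne'
  field_simp
  ring

/-- Watson's lemma for `toddLaplace`. -/
lemma toddLaplace_expansion (n N : ℕ) :
    (fun x : ℝ => toddLaplace n x -
      ∑ j ∈ Finset.range N, (todd (n + 2 + j) : ℝ) * (j.factorial : ℝ) * x⁻¹ ^ (j + 1))
      =O[atTop] fun x => x⁻¹ ^ (N + 1) := by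
  refine (integral_toddRem_div_isBigO (n + 1) N).congr' ?_ EventuallyEq.rfl
  filter_upwards [eventually_gt_atTop 0] with x hx
  have hi : ∀ j ∈ Finset.range N, IntegrableOn (fun t : ℝ =>
      (todd (n + 2 + j) : ℝ) * (t ^ j * Real.exp (-(x * t)))) (Set.Ioi 0) :=
    fun j _ => (integrableOn_pow_mul_exp_neg j hx).const_mul _
  have e : toddLaplace n x = ∫ t in Set.Ioi (0 : ℝ),
      ((∑ j ∈ Finset.range N, (todd (n + 2 + j) : ℝ) * (t ^ j * Real.exp (-(x * t)))) +
        toddRem (n + 1 + N) t / t ^ (n + 1) * Real.exp (-(x * t))) := by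
    refine setIntegral_congr_fun measurableSet_Ioi fun t ht => ?_
    simp only [toddRem_div_eq n N ht, add_mul, Finset.sum_mul, mul_assoc]
  rw [e, integral_add (integrable_finsetSum _ hi) (integrableOn_toddRem_div _ _ hx),
    integral_finsetSum _ hi, eq_sub_iff_add_eq, add_comm]
  congr 1
  refine Finset.sum_congr rfl fun j _ => ?_
  rw [integral_const_mul, integral_pow_mul_exp_neg j hx, mul_assoc]

/-! ### The telescoping relation -/

/-- The power series with the functions against which the coefficients of `exp (-x X)` are
subtracted in `expRem`. -/
noncomputable def cutoffSeries (t : ℝ) : PowerSeries ℝ :=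
  PowerSeries.mk fun p => if p = 0 then Real.exp (-t) / t else (t ^ (p + 1))⁻¹

lemma expRem_div_eq (m : ℕ) (x : ℝ) {t : ℝ} (ht : t ≠ 0) :
    expRem m x t / t ^ (m + 1) = Real.exp (-(x * t)) / t ^ (m + 1) -
      PowerSeries.coeff m (PowerSeries.rescale (-x) (PowerSeries.exp ℝ) * cutoffSeries t) := by
  rw [PowerSeries.coeff_mul, Finset.Nat.sum_antidiagonal_eq_sum_range_succ_mk,
    Finset.sum_range_succ, expRem, sub_sub, sub_div, add_div, Finset.sum_div]
  congr 2
  · refine Finset.sum_congr rfl fun j hj => ?_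
    have hj := Finset.mem_range.1 hj
    have : m - j ≠ 0 := by omega
    have e : t ^ (m + 1) = t ^ j * t ^ (m - j + 1) := by
      rw [← pow_add]; congr 1; omega
    simp only [PowerSeries.coeff_rescale, PowerSeries.coeff_exp, cutoffSeries,
      PowerSeries.coeff_mk, this, if_false, e, eq_ratCast]
    rw [← neg_mul, mul_pow]
    push_cast
    field_simp
  · simp only [PowerSeries.coeff_rescale, PowerSeries.coeff_exp, cutoffSeries,
      PowerSeries.coeff_mk, Nat.sub_self, if_true, eq_ratCast]
    rw [← neg_mul, mul_pow]
    push_cast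
    field_simp
    ring

/-- Coefficient of `X^(n+1)` in the Todd series times `(1 - e^(-X)) e^(-xX) Φ`, which is `X e^(-xX)
Φ`. With `Φ = cutoffSeries t`, all regularising terms cancel, whatever the cutoff is. -/
lemma sum_todd_mul_coeff_sub (n : ℕ) (x : ℝ) (Φ : PowerSeries ℝ) :
    ∑ p ∈ Finset.HasAntidiagonal.antidiagonal (n + 1), (todd p.1 : ℝ) *
      (PowerSeries.coeff p.2 (PowerSeries.rescale (-x) (PowerSeries.exp ℝ) * Φ) -
        PowerSeries.coeff p.2 (PowerSeries.rescale (-(x + 1)) (PowerSeries.exp ℝ) * Φ)) =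
      PowerSeries.coeff n (PowerSeries.rescale (-x) (PowerSeries.exp ℝ) * Φ) := by
  have h1 : PowerSeries.rescale (-(x + 1)) (PowerSeries.exp ℝ) =
      PowerSeries.evalNegHom (PowerSeries.exp ℝ) *
        PowerSeries.rescale (-x) (PowerSeries.exp ℝ) := by
    rw [PowerSeries.evalNegHom, PowerSeries.exp_mul_exp_eq_exp_add]
    congr 2; ring
  have h2 : bernoulli'PowerSeries ℝ * (PowerSeries.rescale (-x) (PowerSeries.exp ℝ) * Φ -
      PowerSeries.rescale (-(x + 1)) (PowerSeries.exp ℝ) * Φ) =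
      PowerSeries.X * (PowerSeries.rescale (-x) (PowerSeries.exp ℝ) * Φ) := by
    rw [h1, ← toddSeries_mul_one_sub ℝ]; ring
  rw [← PowerSeries.coeff_succ_X_mul, ← h2, PowerSeries.coeff_mul]
  refine Finset.sum_congr rfl fun p _ => ?_
  simp [bernoulli'PowerSeries, todd]

/-- The factor `1 - e^(-t)` of the difference of exponentials cancels the denominator of `1 / (1 -
e^(-t))`; the subtracted Laurent polynomial becomes the convolution of Todd coefficients with powers
of `1 / t`. -/
lemma toddRem_div_mul_exp_sub (n : ℕ) (x : ℝ) {t : ℝ} (ht : 0 < t) :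
    toddRem (n + 1) t / t ^ (n + 1) * Real.exp (-(x * t)) -
      toddRem (n + 1) t / t ^ (n + 1) * Real.exp (-((x + 1) * t)) =
    expRem n x t / t ^ (n + 1) -
      ∑ p ∈ Finset.HasAntidiagonal.antidiagonal (n + 1), (todd p.1 : ℝ) *
        (expRem p.2 x t / t ^ (p.2 + 1) - expRem p.2 (x + 1) t / t ^ (p.2 + 1)) := by
  have ht0 : t ≠ 0 := ht.ne'
  have he := (one_sub_exp_neg_pos ht).ne'
  have hexp : Real.exp (-((x + 1) * t)) = Real.exp (-(x * t)) * Real.exp (-t) := by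
    rw [← Real.exp_add]; congr 1; ring
  simp only [expRem_div_eq _ _ ht0]
  have hsplit : ∀ p : ℕ × ℕ, (todd p.1 : ℝ) *
      (Real.exp (-(x * t)) / t ^ (p.2 + 1) - PowerSeries.coeff p.2
        (PowerSeries.rescale (-x) (PowerSeries.exp ℝ) * cutoffSeries t) -
      (Real.exp (-((x + 1) * t)) / t ^ (p.2 + 1) - PowerSeries.coeff p.2
        (PowerSeries.rescale (-(x + 1)) (PowerSeries.exp ℝ) * cutoffSeries t))) =
      (todd p.1 : ℝ) / t ^ (p.2 + 1) *
        (Real.exp (-(x * t)) - Real.exp (-((x + 1) * t))) -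
      (todd p.1 : ℝ) * (PowerSeries.coeff p.2
        (PowerSeries.rescale (-x) (PowerSeries.exp ℝ) * cutoffSeries t) -
      PowerSeries.coeff p.2
        (PowerSeries.rescale (-(x + 1)) (PowerSeries.exp ℝ) * cutoffSeries t)) := fun p => by ring
  simp only [hsplit]
  rw [Finset.sum_sub_distrib, sum_todd_mul_coeff_sub, ← Finset.sum_mul]
  have hs : ∑ p ∈ Finset.HasAntidiagonal.antidiagonal (n + 1), (todd p.1 : ℝ) / t ^ (p.2 + 1) =
      (∑ m ∈ Finset.range (n + 1 + 1), (todd m : ℝ) * t ^ m / t) / t ^ (n + 1) := by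
    rw [Finset.Nat.sum_antidiagonal_eq_sum_range_succ_mk, Finset.sum_div]
    refine Finset.sum_congr rfl fun m hm => ?_
    have hm := Finset.mem_range.1 hm
    have e : t ^ (n + 1) = t ^ m * t ^ (n + 1 - m) := by
      rw [← pow_add]; congr 1; omega
    simp only [e]
    field_simp
    ring
  rw [hs, hexp, toddRem]
  field_simp
  ring

/-- The value of `∫ t in Ioi 0, expRem m x t / t ^ (m + 1)`. -/
noncomputable def logMoment (m : ℕ) (x : ℝ) : ℝ :=
  (-1) ^ (m + 1) * x ^ m / (m.factorial : ℝ) * (Real.log x - (harmonic m : ℝ))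

/-- The combination of `logMoment`s whose difference compensates that of `toddLaplace`. -/
noncomputable def toddLog (n : ℕ) (x : ℝ) : ℝ :=
  ∑ p ∈ Finset.HasAntidiagonal.antidiagonal (n + 1), (todd p.1 : ℝ) * logMoment p.2 x

lemma toddLaplace_sub (n : ℕ) {x : ℝ} (hx : 0 < x) :
    toddLaplace n x - toddLaplace n (x + 1) =
      logMoment n x - (toddLog n x - toddLog n (x + 1)) := by
  have hx1 : 0 < x + 1 := by linarith
  have hd : ∀ p : ℕ × ℕ, IntegrableOn (fun t : ℝ =>
      expRem p.2 x t / t ^ (p.2 + 1) - expRem p.2 (x + 1) t / t ^ (p.2 + 1)) (Set.Ioi 0) :=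
    fun p => (integrableOn_expRem_div p.2 hx).sub (integrableOn_expRem_div p.2 hx1)
  have hi : ∀ p ∈ Finset.HasAntidiagonal.antidiagonal (n + 1), IntegrableOn (fun t : ℝ =>
      (todd p.1 : ℝ) *
        (expRem p.2 x t / t ^ (p.2 + 1) - expRem p.2 (x + 1) t / t ^ (p.2 + 1))) (Set.Ioi 0) :=
    fun p _ => (hd p).const_mul _
  rw [toddLaplace, toddLaplace, ← integral_sub (integrableOn_toddRem_div (n + 1) 0 hx)
    (integrableOn_toddRem_div (n + 1) 0 hx1),
    setIntegral_congr_fun measurableSet_Ioi fun t ht => toddRem_div_mul_exp_sub n x ht,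
    integral_sub (integrableOn_expRem_div n hx) (integrable_finsetSum _ hi),
    integral_finsetSum _ hi, integral_expRem_div n hx, toddLog, toddLog,
    ← Finset.sum_sub_distrib]
  congr 1
  refine Finset.sum_congr rfl fun p _ => ?_
  rw [integral_const_mul, integral_sub (integrableOn_expRem_div p.2 hx)
    (integrableOn_expRem_div p.2 hx1), integral_expRem_div _ hx, integral_expRem_div _ hx1,
    ← mul_sub]
  rfl

/-- Stopping before `k = s` keeps the upper end of the telescoping sum at `s` instead of `s + 1`, so
the expansion comes out directly in `s`. -/
lemma sum_logMoment (n : ℕ) {s : ℕ} (hs : 1 ≤ s) :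
    ∑ k ∈ Finset.Ico 1 s, logMoment n k =
      (toddLaplace n 1 + toddLog n 1) - (toddLaplace n s + toddLog n s) := by
  induction s, hs using Nat.le_induction with
  | base => simp
  | succ s hs ih =>
    have h := toddLaplace_sub n (x := s) (by exact_mod_cast hs)
    rw [Finset.sum_Ico_succ_top hs, ih]
    push_cast
    linarith

/-! ### Existence of the asymptotic expansion -/

/-- Faulhaber's polynomial, whose value at `s` is `∑ k < s, k ^ n`. -/
noncomputable def faulhaber (n : ℕ) : Polynomial ℚ :=
  ∑ i ∈ Finset.range (n + 1),
    Polynomial.C (bernoulli i * ((n + 1).choose i) / (n + 1)) * Polynomial.X ^ (n + 1 - i)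

lemma faulhaber_coeff_zero (n : ℕ) : (faulhaber n).coeff 0 = 0 := by
  rw [faulhaber, Polynomial.finsetSum_coeff]
  refine Finset.sum_eq_zero fun i hi => ?_
  have := Finset.mem_range.1 hi
  rw [Polynomial.coeff_C_mul, Polynomial.coeff_X_pow, if_neg (by omega), mul_zero]

lemma aeval_faulhaber (n s : ℕ) :
    Polynomial.aeval (s : ℝ) (faulhaber n) = ∑ k ∈ Finset.range s, (k : ℝ) ^ n := by
  have h := congrArg (fun q : ℚ => (q : ℝ)) (sum_range_pow s n)
  push_cast at h
  rw [h, faulhaber, map_sum]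
  refine Finset.sum_congr rfl fun i _ => ?_
  simp
  ring

/-- Faulhaber's sum starts at `k = 0`. The extra term `0^n` is nonzero only for `n = 0`, where `H_0
= 0`. -/
lemma harmonic_mul_sum_Ico_pow (n s : ℕ) (hs : 1 ≤ s) :
    (harmonic n : ℝ) * ∑ k ∈ Finset.Ico 1 s, (k : ℝ) ^ n =
      (harmonic n : ℝ) * Polynomial.aeval (s : ℝ) (faulhaber n) := by
  rcases eq_or_ne n 0 with rfl | hn
  · simp
  · rw [aeval_faulhaber, Finset.range_eq_Ico, Finset.sum_eq_sum_Ico_succ_bot hs]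
    simp [hn]

/-- The coefficient of `log x` in `toddLog`. -/
noncomputable def toddLogCoeff (n : ℕ) : Polynomial ℚ :=
  ∑ p ∈ Finset.HasAntidiagonal.antidiagonal (n + 1),
    Polynomial.C (todd p.1 * ((-1) ^ (p.2 + 1) / (p.2.factorial : ℚ))) * Polynomial.X ^ p.2

/-- The polynomial part of `toddLog`. -/
noncomputable def toddLogPoly (n : ℕ) : Polynomial ℚ :=
  ∑ p ∈ Finset.HasAntidiagonal.antidiagonal (n + 1),
    Polynomial.C (todd p.1 * ((-1) ^ p.2 / (p.2.factorial : ℚ)) * harmonic p.2) *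
      Polynomial.X ^ p.2

/-- The constant term carries `H_0 = 0`; hence `toddLog` does not affect the constant of the
expansion at `s`. -/
lemma toddLogPoly_coeff_zero (n : ℕ) : (toddLogPoly n).coeff 0 = 0 := by
  rw [toddLogPoly, Polynomial.finsetSum_coeff]
  refine Finset.sum_eq_zero fun p _ => ?_
  rw [Polynomial.coeff_C_mul, Polynomial.coeff_X_pow]
  split_ifs with h
  · simp [← h]
  · simp

lemma toddLog_eq (n : ℕ) (x : ℝ) :
    toddLog n x = Polynomial.aeval x (toddLogCoeff n) * Real.log x +
      Polynomial.aeval x (toddLogPoly n) := by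
  rw [toddLog, toddLogCoeff, toddLogPoly, map_sum, map_sum, Finset.sum_mul,
    ← Finset.sum_add_distrib]
  refine Finset.sum_congr rfl fun p _ => ?_
  simp [logMoment]
  ring

/-- At `1` the logarithm vanishes and only the harmonic terms survive, with `b_(n-k)` being the Todd
coefficient of index `n + 1 - k`. -/
lemma toddLog_one (n : ℕ) : toddLog n 1 = -(ratR n : ℝ) := by
  have h : (toddLogPoly n).eval 1 = -ratR n := by
    rw [toddLogPoly, Polynomial.eval_finsetSum, ratR, ← Finset.Nat.sum_antidiagonal_swap,
      Finset.Nat.sum_antidiagonal_eq_sum_range_succ_mk, Finset.sum_range_succ',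
      ← Finset.Ico_add_one_right_eq_Icc, Finset.sum_Ico_eq_sum_range, ← Finset.sum_neg_distrib]
    simp only [Prod.swap, Polynomial.eval_mul, Polynomial.eval_C, Polynomial.eval_pow,
      Polynomial.eval_X, one_pow, mul_one, harmonic_zero, mul_zero, add_zero]
    refine Finset.sum_congr rfl fun k hk => ?_
    have hk := Finset.mem_range.1 hk
    have e : (n : ℤ) - ((1 + k : ℕ) : ℤ) = ((n + 1 - (k + 1) : ℕ) : ℤ) - 1 := by omega
    rw [e, laurentB_sub_one, add_comm 1 k]
    ring
  rw [toddLog_eq, Real.log_one, mul_zero, zero_add, ← Rat.cast_neg, ← h]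
  simp [Polynomial.aeval_def]

/-- The coefficients in the asymptotic series of the sums `∑ k ≤ s, k ^ n log k`. -/
noncomputable def remainderSeries (n : ℕ) : PowerSeries ℚ :=
  PowerSeries.mk fun j => if j = 0 then 0 else
    -((-1) ^ (n + 1) * (n.factorial : ℚ)) * (todd (n + 1 + j) * ((j - 1).factorial : ℚ))

lemma sum_pow_mul_log_eq (n : ℕ) {s : ℕ} (hs : 1 ≤ s) :
    ∑ k ∈ Finset.Icc 1 s, (k : ℝ) ^ n * Real.log k =
      (s : ℝ) ^ n * Real.log s + (harmonic n : ℝ) * Polynomial.aeval (s : ℝ) (faulhaber n) +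
      (-1) ^ (n + 1) * (n.factorial : ℝ) *
        ((toddLaplace n 1 + toddLog n 1) - (toddLaplace n s + toddLog n s)) := by
  have hf : (n.factorial : ℝ) ≠ 0 := by positivity
  rw [← sum_logMoment n hs, ← harmonic_mul_sum_Ico_pow n s hs, Finset.mul_sum, Finset.mul_sum,
    ← Finset.Ico_add_one_right_eq_Icc, Finset.sum_Ico_succ_top hs, add_comm, add_assoc,
    ← Finset.sum_add_distrib]
  congr 1
  refine Finset.sum_congr rfl fun k _ => ?_
  have h1 : ((-1 : ℝ) ^ (n + 1)) * (-1) ^ (n + 1) = 1 := by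
    rw [← mul_pow]; norm_num
  rw [logMoment]
  field_simp
  linear_combination (-(k : ℝ) ^ n * (Real.log k - (harmonic n : ℝ))) * h1

lemma isStirlingRamanujanConstant (n : ℕ) :
    IsStirlingRamanujanConstant n
      ((-1) ^ (n + 1) * (n.factorial : ℝ) * (toddLaplace n 1 + toddLog n 1)) := by
  -- The summand `k = s`, left out of the telescoping, supplies `X ^ n`.
  refine ⟨Polynomial.X ^ n - Polynomial.C ((-1) ^ (n + 1) * (n.factorial : ℚ)) * toddLogCoeff n,
    Polynomial.C (harmonic n) * faulhaber n -
      Polynomial.C ((-1) ^ (n + 1) * (n.factorial : ℚ)) * toddLogPoly n,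
    remainderSeries n, ?_, ?_, fun N => ?_⟩
  · rw [Polynomial.coeff_sub, Polynomial.coeff_C_mul, Polynomial.coeff_C_mul,
      faulhaber_coeff_zero, toddLogPoly_coeff_zero]
    simp
  · simp [remainderSeries]
  · have h := ((toddLaplace_expansion n N).comp_tendsto tendsto_natCast_atTop_atTop).const_mul_left
      (-((-1) ^ (n + 1) * (n.factorial : ℝ)))
    refine h.congr' ?_ EventuallyEq.rfl
    filter_upwards [eventually_ge_atTop 1] with s hs
    rw [sum_pow_mul_log_eq n hs, toddLog_eq n s, Finset.sum_range_succ']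
    have e : ∑ k ∈ Finset.range N, ((PowerSeries.coeff (k + 1) (remainderSeries n) : ℚ) : ℝ) *
        (s : ℝ)⁻¹ ^ (k + 1) = -((-1) ^ (n + 1) * (n.factorial : ℝ)) *
        ∑ j ∈ Finset.range N, (todd (n + 2 + j) : ℝ) * (j.factorial : ℝ) *
          (s : ℝ)⁻¹ ^ (j + 1) := by
      rw [Finset.mul_sum]
      refine Finset.sum_congr rfl fun j _ => ?_
      have : n + 1 + (j + 1) = n + 2 + j := by ring
      simp [remainderSeries, this]
      ring
    rw [e]
    simp [remainderSeries]
    ring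

/-! ### Uniqueness of the constant -/

/-- If `p = 0`, then `q` tends to `0`, so it is constant and zero. If `p ≠ 0` and `deg q ≤ deg p`,
dividing by `p` would bound `log s`. If `deg q > deg p`, then `s p = O(q) = O(p log s)`, which
contradicts `log s = o(s)`. -/
lemma Polynomial.eval_zero_eq_zero_of_tendsto_log {p q : Polynomial ℝ}
    (h : Tendsto (fun s : ℕ => p.eval (s : ℝ) * Real.log s + q.eval (s : ℝ)) atTop (𝓝 0)) :
    q.eval 0 = 0 := by
  have hcast := tendsto_natCast_atTop_atTop (R := ℝ)
  have hlog : (fun s : ℕ => Real.log s) =o[atTop] fun s : ℕ => (s : ℝ) :=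
    Real.isLittleO_log_id_atTop.comp_tendsto hcast
  have hlog_top : Tendsto (fun s : ℕ => Real.log s) atTop atTop :=
    Real.tendsto_log_atTop.comp hcast
  by_cases hp : p = 0
  · have hq : Tendsto (fun s : ℕ => q.eval (s : ℝ)) atTop (𝓝 0) := by simpa [hp] using h
    rcases lt_or_ge 0 q.degree with hd | hd
    · have h1 := (q.abs_tendsto_atTop hd).comp hcast
      have h2 := hq.abs
      exact absurd h2 (not_tendsto_nhds_of_tendsto_atTop h1 _)
    · rw [Polynomial.eq_C_of_degree_le_zero hd] at hq ⊢
      simp only [Polynomial.eval_C] at hq ⊢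
      exact tendsto_nhds_unique tendsto_const_nhds hq
  exfalso
  have hp1 : (fun _ : ℕ => (1 : ℝ)) =O[atTop] fun s : ℕ => p.eval (s : ℝ) := by
    have := Polynomial.isBigO_atTop_of_degree_le (𝕜 := ℝ) (1 : Polynomial ℝ) p
      (by rw [Polynomial.degree_one]; exact Polynomial.zero_le_degree_iff.2 hp)
    simpa [Function.comp_def] using this.comp_tendsto hcast
  have hp0 : ∀ᶠ s : ℕ in atTop, p.eval (s : ℝ) ≠ 0 :=
    hcast.eventually (p.eventually_atTop_not_isRoot hp)
  have hO1 := h.isBigO_one ℝ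
  have hcancel : ∀ {f g : ℕ → ℝ}, (fun s : ℕ => p.eval (s : ℝ) * f s) =O[atTop]
      (fun s : ℕ => p.eval (s : ℝ) * g s) → f =O[atTop] g := by
    intro f g hfg
    have := (isBigO_refl (fun s : ℕ => (p.eval (s : ℝ))⁻¹) atTop).mul hfg
    refine this.congr' ?_ ?_ <;>
    · filter_upwards [hp0] with s hs
      rw [inv_mul_cancel_left₀ hs]
  have hlog1 : (fun _ : ℕ => (1 : ℝ)) =o[atTop] fun s : ℕ => Real.log s :=
    isLittleO_const_left.2 (Or.inr (tendsto_norm_atTop_atTop.comp hlog_top))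
  rcases le_or_gt q.degree p.degree with hd | hd
  · have hq : (fun s : ℕ => q.eval (s : ℝ)) =O[atTop] fun s : ℕ => p.eval (s : ℝ) :=
      (Polynomial.isBigO_atTop_of_degree_le q p hd).comp_tendsto hcast
    have h1 : (fun s : ℕ => p.eval (s : ℝ) * Real.log s) =O[atTop]
        fun s : ℕ => p.eval (s : ℝ) * 1 := by
      simpa using (hO1.trans hp1).sub hq
    exact isLittleO_irrefl (Frequently.of_forall fun _ => one_ne_zero)
      (hlog1.trans_isBigO (hcancel h1))
  · have hd' : (Polynomial.X * p).degree ≤ q.degree := by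
      have hq0 : q ≠ 0 := fun h0 => by simp [h0] at hd
      rw [Polynomial.degree_eq_natDegree hp, Polynomial.degree_eq_natDegree hq0] at hd
      rw [Polynomial.degree_mul, Polynomial.degree_X, Polynomial.degree_eq_natDegree hp,
        Polynomial.degree_eq_natDegree hq0, add_comm]
      exact_mod_cast hd
    have hq : (fun s : ℕ => p.eval (s : ℝ) * s) =O[atTop] fun s : ℕ => q.eval (s : ℝ) := by
      have := (Polynomial.isBigO_atTop_of_degree_le _ q hd').comp_tendsto hcast
      simpa [Function.comp_def, mul_comm] using this
    have hplog : (fun _ : ℕ => (1 : ℝ)) =O[atTop] fun s : ℕ => p.eval (s : ℝ) * Real.log s := by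
      simpa using hp1.mul hlog1.isBigO
    have hq2 : (fun s : ℕ => q.eval (s : ℝ)) =O[atTop]
        fun s : ℕ => p.eval (s : ℝ) * Real.log s := by
      simpa using (hO1.trans hplog).sub (isBigO_refl _ _)
    have hs := (hcancel (hq.trans hq2)).trans_isLittleO hlog
    refine isLittleO_irrefl (Eventually.frequently ?_) hs
    filter_upwards [eventually_ge_atTop 1] with s hs
    positivity

lemma IsStirlingRamanujanConstant.unique {n : ℕ} {S T : ℝ}
    (hS : IsStirlingRamanujanConstant n S) (hT : IsStirlingRamanujanConstant n T) : S = T := by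
  obtain ⟨A, B, R, hB, hR, h⟩ := hS
  obtain ⟨A', B', R', hB', hR', h'⟩ := hT
  have hinv : Tendsto (fun s : ℕ => ((s : ℝ)⁻¹) ^ (0 + 1)) atTop (𝓝 0) := by
    simpa using tendsto_inv_atTop_nhds_zero_nat (𝕜 := ℝ)
  -- Order `N = 0` suffices, as both series `R` have no constant term.
  have hd := ((h 0).sub (h' 0)).trans_tendsto hinv
  have key := Polynomial.eval_zero_eq_zero_of_tendsto_log
    (p := (A' - A).map (algebraMap ℚ ℝ))
    (q := (B' - B).map (algebraMap ℚ ℝ) + Polynomial.C (T - S)) (by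
      refine hd.congr fun s => ?_
      simp [Polynomial.aeval_def, Polynomial.eval_map, hR, hR']
      ring)
  rw [Polynomial.eval_add, Polynomial.eval_C, ← Polynomial.coeff_zero_eq_eval_zero,
    Polynomial.coeff_map, Polynomial.coeff_sub, hB, hB'] at key
  simp at key
  linarith

/-! ### The integral formula -/

lemma sum_laurentB_eq (n : ℕ) {t : ℝ} (ht : t ≠ 0) :
    ∑ k ∈ Finset.Icc (-1 : ℤ) (n : ℤ), (laurentB k : ℝ) * t ^ k =
      ∑ m ∈ Finset.range (n + 1 + 1), (todd m : ℝ) * t ^ m / t := by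
  refine Finset.sum_nbij' (fun k => (k + 1).toNat) (fun m => (m : ℤ) - 1) ?_ ?_ ?_ ?_ ?_
  · intro k hk; simp at hk ⊢; omega
  · intro m hm; simp at hm ⊢; omega
  · intro k hk; simp at hk ⊢; omega
  · intro m hm; simp
  · intro k hk
    have hk := Finset.mem_Icc.1 hk
    obtain ⟨m, rfl⟩ : ∃ m : ℕ, k = (m : ℤ) - 1 := ⟨(k + 1).toNat, by omega⟩
    rw [laurentB_sub_one, zpow_sub_one₀ ht, zpow_natCast]
    simp
    ring

/-- The integrand of the integral formula for the Stirling-Ramanujan constants. -/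
noncomputable def stirlingIntegrand (n : ℕ) (t : ℝ) : ℝ :=
  1 / t ^ n *
    (1 / (1 - Real.exp (-t))
      - ∑ k ∈ Finset.Icc (-1 : ℤ) (n : ℤ), (laurentB k : ℝ) * t ^ k
      - (ratR n : ℝ) * t ^ (n + 1)) * (Real.exp (-t) / t)

lemma stirlingIntegrand_eq (n : ℕ) {t : ℝ} (ht : t ≠ 0) :
    stirlingIntegrand n t =
      toddRem (n + 1) t / t ^ (n + 1) * Real.exp (-(1 * t)) - (ratR n : ℝ) * Real.exp (-t) := by
  rw [stirlingIntegrand, sum_laurentB_eq n ht, toddRem, one_mul]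
  field_simp
  ring

lemma integrableOn_stirlingIntegrand (n : ℕ) :
    IntegrableOn (stirlingIntegrand n) (Set.Ioi 0) :=
  (integrableOn_congr_fun (fun _ ht => stirlingIntegrand_eq n (ne_of_gt ht)) measurableSet_Ioi).2
    ((integrableOn_toddRem_div (n + 1) 0 one_pos).sub ((integrableOn_exp_neg_Ioi 0).const_mul _))

lemma integral_stirlingIntegrand (n : ℕ) :
    ∫ t in Set.Ioi 0, stirlingIntegrand n t = toddLaplace n 1 + toddLog n 1 := by
  rw [setIntegral_congr_fun measurableSet_Ioi fun _ ht => stirlingIntegrand_eq n (ne_of_gt ht),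
    integral_sub (integrableOn_toddRem_div (n + 1) 0 one_pos)
      ((integrableOn_exp_neg_Ioi 0).const_mul _), integral_const_mul, integral_exp_neg_Ioi_zero,
    toddLog_one, mul_one, sub_eq_add_neg]
  rfl

/-! ### Exponential periods -/

open MvPolynomial in
/-- The numerator of `c` times the integrand of the Stirling-Ramanujan constant. -/
noncomputable def stirlingNum (n : ℕ) (c : ℚ) : MvPolynomial (Fin 2) ℚ :=
  C c * X 1 * (X 0 - (1 - X 1) *
    (∑ m ∈ Finset.range (n + 1 + 1), C (todd m) * X 0 ^ m + C (ratR n) * X 0 ^ (n + 2)))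

open MvPolynomial in
/-- The denominator of the integrand of the Stirling-Ramanujan constant. -/
noncomputable def stirlingDen (n : ℕ) : MvPolynomial (Fin 2) ℚ :=
  X 0 ^ (n + 2) * (1 - X 1)

lemma evalExp_stirlingDen (n : ℕ) (t : ℂ) :
    evalExp (stirlingDen n) t = t ^ (n + 2) * (1 - Complex.exp (-t)) := by
  simp [evalExp, stirlingDen]

lemma evalExp_stirlingNum (n : ℕ) (c : ℚ) (t : ℂ) :
    evalExp (stirlingNum n c) t = c * Complex.exp (-t) * (t - (1 - Complex.exp (-t)) *
      (∑ m ∈ Finset.range (n + 1 + 1), (todd m : ℂ) * t ^ m + (ratR n : ℂ) * t ^ (n + 2))) := by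
  simp [evalExp, stirlingNum]

lemma evalExp_stirlingDen_ofReal_ne_zero (n : ℕ) {t : ℝ} (ht : 0 < t) :
    evalExp (stirlingDen n) t ≠ 0 := by
  rw [evalExp_stirlingDen]
  have h1 : (t : ℂ) ≠ 0 := by exact_mod_cast ht.ne'
  have h2 : (1 : ℂ) - Complex.exp (-t) ≠ 0 := by
    exact_mod_cast (one_sub_exp_neg_pos ht).ne'
  exact mul_ne_zero (pow_ne_zero _ h1) h2

lemma evalExp_stirlingNum_div (n : ℕ) (c : ℚ) {t : ℝ} (ht : 0 < t) :
    evalExp (stirlingNum n c) t / evalExp (stirlingDen n) t =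
      ((c * stirlingIntegrand n t : ℝ) : ℂ) := by
  have h0 : t ≠ 0 := ht.ne'
  have h2 := (one_sub_exp_neg_pos ht).ne'
  rw [evalExp_stirlingNum, evalExp_stirlingDen, stirlingIntegrand, sum_laurentB_eq n h0,
    ← Finset.sum_div]
  norm_cast
  field_simp
  ring

/-- Modulo `1 - X 1` the numerator is `c * X 0`, so a common divisor with `1 - X 1` divides `X 0`,
which is prime to `1 - X 1`. -/
lemma isRelPrime_stirling (n : ℕ) {c : ℚ} (hc : c ≠ 0) :
    IsRelPrime (stirlingNum n c) (stirlingDen n) := by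
  have hirr : Irreducible (MvPolynomial.X 0 : MvPolynomial (Fin 2) ℚ) :=
    (MvPolynomial.X_prime).irreducible
  have h1 : IsRelPrime (MvPolynomial.X 0 : MvPolynomial (Fin 2) ℚ) (stirlingNum n c) := by
    rw [hirr.isRelPrime_iff_not_dvd]
    rintro ⟨q, hq⟩
    -- At `X 0 = 0` the numerator is `-c Y (1 - Y)` with `Y = X 1`; any `Y` other than `0` and `1`
    -- shows it nonzero.
    have h := congrArg (MvPolynomial.eval ![(0 : ℚ), 2]) hq
    simp [stirlingNum, Finset.sum_range_succ', hc] at h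
    norm_num at h
  have h2 : IsRelPrime (MvPolynomial.X 0 : MvPolynomial (Fin 2) ℚ) (1 - MvPolynomial.X 1) := by
    rw [hirr.isRelPrime_iff_not_dvd]
    rintro ⟨q, hq⟩
    have h := congrArg (MvPolynomial.eval ![(0 : ℚ), 0]) hq
    simp at h
  refine IsRelPrime.mul_right h1.symm.pow_right ?_
  intro d hd hd1
  refine h2 ?_ hd1
  have hcd : d ∣ MvPolynomial.C c * MvPolynomial.X 0 := by
    have e : MvPolynomial.C c * MvPolynomial.X 0 = stirlingNum n c + (1 - MvPolynomial.X 1) *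
        (MvPolynomial.C c * MvPolynomial.X 0 + MvPolynomial.C c * MvPolynomial.X 1 *
          (∑ m ∈ Finset.range (n + 1 + 1), MvPolynomial.C (todd m) * MvPolynomial.X 0 ^ m +
            MvPolynomial.C (ratR n) * MvPolynomial.X 0 ^ (n + 2))) := by
      rw [stirlingNum]; ring
    rw [e]
    exact dvd_add hd (hd1.mul_right _)
  have hu : IsUnit (MvPolynomial.C c : MvPolynomial (Fin 2) ℚ) := (IsUnit.mk0 c hc).map _
  exact (hu.dvd_mul_left).1 hcd

/-- The values at `(1, 0)` and `(1, 1)` differ, so `X 1` occurs. This makes `∞` a singularity of the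
integrand. -/
lemma degreeOf_stirlingDen_ne_zero (n : ℕ) : (stirlingDen n).degreeOf 1 ≠ 0 := by
  intro h
  have hv : (1 : Fin 2) ∉ (stirlingDen n).vars := fun hv =>
    MvPolynomial.mem_vars_iff_degreeOf_ne_zero.1 hv h
  have := MvPolynomial.eval₂Hom_congr' (f₁ := RingHom.id ℚ) (f₂ := RingHom.id ℚ)
    (g₁ := ![1, 0]) (g₂ := ![1, 1]) (p₁ := stirlingDen n) rfl (fun i hi _ => by
      fin_cases i
      · rfl
      · exact absurd hi hv) rfl
  simp [stirlingDen] at this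

/-- The substitution `t = e^u` parametrises the open path from `0` to `∞` by the whole real line. -/
lemma tendsto_intervalIntegral_comp_exp {f : ℝ → ℝ} (hf : IntegrableOn f (Set.Ioi 0)) :
    Tendsto (fun p : ℝ × ℝ => ∫ u in p.1..p.2, f (Real.exp u) * Real.exp u)
      (atBot ×ˢ atTop) (𝓝 (∫ t in Set.Ioi 0, f t)) := by
  have h : IntegrableOn (fun u => |Real.exp u| • f (Real.exp u)) Set.univ := by
    rw [← integrableOn_image_iff_integrableOn_abs_deriv_smul MeasurableSet.univ
      (fun u _ => (Real.hasDerivAt_exp u).hasDerivWithinAt) Real.exp_injective.injOn]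
    simpa [Set.image_univ, Real.range_exp] using hf
  have h2 : ∫ t in Set.Ioi 0, f t = ∫ u, f (Real.exp u) * Real.exp u := by
    have := integral_image_eq_integral_abs_deriv_smul MeasurableSet.univ
      (fun u _ => (Real.hasDerivAt_exp u).hasDerivWithinAt) Real.exp_injective.injOn f
    simpa [Set.image_univ, Real.range_exp, mul_comm] using this
  rw [h2]
  refine intervalIntegral_tendsto_integral ?_ tendsto_fst tendsto_snd
  simpa [mul_comm] using h

lemma isExponentialPeriod_integral_stirlingIntegrand (n : ℕ) {c : ℚ} (hc : c ≠ 0) :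
    IsExponentialPeriod ((c * ∫ t in Set.Ioi 0, stirlingIntegrand n t : ℝ) : ℂ) := by
  refine ⟨stirlingNum n c, stirlingDen n, ?_, isRelPrime_stirling n hc,
    fun u => (Real.exp u : ℂ), ?_, fun u => evalExp_stirlingDen_ofReal_ne_zero n (Real.exp_pos u),
    ?_, ?_, ?_⟩
  · rintro h
    exact degreeOf_stirlingDen_ne_zero n (by simp [h])
  · exact Complex.ofRealCLM.contDiff.comp Real.contDiff_exp
  · refine Or.inl ⟨0, ?_, by simp [evalExp_stirlingDen]⟩
    exact (Complex.continuous_ofReal.tendsto' 0 0 Complex.ofReal_zero).comp Real.tendsto_exp_atBot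
  · refine Or.inr ⟨?_, fun h => degreeOf_stirlingDen_ne_zero n h.2.1⟩
    refine tendsto_cocompact_of_tendsto_dist_comp_atTop 0 ?_
    simpa [abs_of_pos, Real.exp_pos] using Real.tendsto_exp_atTop
  · have h := tendsto_intervalIntegral_comp_exp ((integrableOn_stirlingIntegrand n).const_mul c)
    rw [integral_const_mul] at h
    refine ((Complex.continuous_ofReal.tendsto _).comp h).congr fun p => ?_
    rw [Function.comp_apply, ← intervalIntegral.integral_ofReal]
    refine intervalIntegral.integral_congr fun u _ => ?_
    have hd : deriv (fun u : ℝ => (Real.exp u : ℂ)) u = (Real.exp u : ℂ) :=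
      (Real.hasDerivAt_exp u).ofReal_comp.deriv
    simp only [hd, evalExp_stirlingNum_div n c (Real.exp_pos u), Complex.ofReal_mul]

theorem theorem1 (n : ℕ) :
    -- the coefficients of `1 / (1 - e ^ (-t))` are given by the Bernoulli numbers
    (∀ m : ℕ, laurentB ((m : ℤ) - 1) = (-1) ^ m * bernoulli m / (m.factorial : ℚ)) ∧
    -- and the Laurent series converges to this function on the punctured disc of radius `2 π`
    (∀ t : ℂ, t ≠ 0 → ‖t‖ < 2 * Real.pi →
      HasSum (fun m : ℕ => (laurentB ((m : ℤ) - 1) : ℂ) * t ^ ((m : ℤ) - 1))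
        (1 / (1 - Complex.exp (-t)))) ∧
    -- the integral converges absolutely
    IntegrableOn
      (fun t : ℝ =>
        1 / t ^ n *
          (1 / (1 - Real.exp (-t))
            - ∑ k ∈ Finset.Icc (-1 : ℤ) (n : ℤ), (laurentB k : ℝ) * t ^ k
            - (ratR n : ℝ) * t ^ (n + 1)) * (Real.exp (-t) / t))
      (Set.Ioi 0) ∧
    -- the asymptotic expansion exists and determines its constant term
    (∃! S : ℝ, IsStirlingRamanujanConstant n S) ∧
    -- the constant is given by the integral formula and is an exponential period
    (∀ S : ℝ, IsStirlingRamanujanConstant n S →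
      S = (-1) ^ (n + 1) * (n.factorial : ℝ) *
          ∫ t in Set.Ioi (0 : ℝ),
            1 / t ^ n *
              (1 / (1 - Real.exp (-t))
                - ∑ k ∈ Finset.Icc (-1 : ℤ) (n : ℤ), (laurentB k : ℝ) * t ^ k
                - (ratR n : ℝ) * t ^ (n + 1)) * (Real.exp (-t) / t) ∧
      IsExponentialPeriod (S : ℂ)) := by
  have hex := isStirlingRamanujanConstant n
  refine ⟨fun m => by rw [laurentB_sub_one, todd_eq], fun t ht0 ht => hasSum_laurentB ht0 ht,
    integrableOn_stirlingIntegrand n, ⟨_, hex, fun T hT => hT.unique hex⟩, fun S hS => ?_⟩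
  have hSeq : S = (-1) ^ (n + 1) * (n.factorial : ℝ) *
      ∫ t in Set.Ioi 0, stirlingIntegrand n t := by
    rw [integral_stirlingIntegrand]
    exact hS.unique hex
  refine ⟨hSeq, ?_⟩
  -- The rational prefactor is absorbed into the numerator of the integrand.
  have h := isExponentialPeriod_integral_stirlingIntegrand n
    (c := (-1) ^ (n + 1) * (n.factorial : ℚ)) (by positivity)
  rw [hSeq]
  push_cast at h ⊢
  exact h
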